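/- Let $n$ be a positive integer and let $f:\mathbb{Z}^n\to\mathbb{Z}\cup\{+\infty\}$ be an integer-valued function whose effective domain $\operatorname{dom} f=\{x\in\mathbb{Z}^n : f(x)<+\infty\}$ is nonempty. For a function $g$ on $\mathbb{Z}^n$ define its integral conjugate by $$g^{\bullet}(p)=\sup\{\langle p,x\rangle-g(x) : x\in\mathbb{Z}^n\}\qquad(p\in\mathbb{Z}^n),\qquad \langle p,x\rangle=\sum_{i=1}^n p_ix_i,$$ and let $f^{\bullet\bullet}=(f^{\bullet})^{\bullet}$ be the integral biconjugate of $f$. Then $f^{\bullet\bullet}(x)=f(x)$ for every $x\in\mathbb{Z}^n$ (including those with $f(x)=+\infty$) in each of the following cases: 1. $f$ is separable convex: $f(x)=\varphi_1(x_1)+\cdots+\varphi_n(x_n)$ with functions $\varphi_i:\mathbb{Z}\to\mathbb{R}\cup\{+\infty\}$ that are convex, i.e. $\{t:\varphi_i(t)<+\infty\}$ is an interval of integers and $\varphi_i(t-1)+\varphi_i(t+1)\ge 2\varphi_i(t)$ for all $t\in\mathbb{Z}$. 2. $f$ is L$^\natural$-convex: for all $x,y\in\mathbb{Z}^n$, $$f(x)+f(y)\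 \ge\ f\left(\left\lceil\tfrac{x+y}{2}\right\rceil\right)+f\left(\left\lfloor\tfrac{x+y}{2}\right\rfloor\right),\qquad(*)$$ with componentwise rounding up and down. 3. $f$ is L-convex: $f(x)+f(y)\ge f(x\vee y)+f(x\wedge y)$ for all $x,y\in\mathbb{Z}^n$ (componentwise maximum and minimum; this property is called submodularity), and there is $r\in\mathbb{R}$ with $f(x+(1,\dots,1))=f(x)+r$ for all $x\in\mathbb{Z}^n$. 4. $f$ is M$^\natural$-convex: for all $x,y\in\mathbb{Z}^n$ and every $i$ with $x_i>y_i$, either $f(x)+f(y)\ge f(x-e_i)+f(y+e_i)$, or there is $j$ with $x_j<y_j$ and $f(x)+f(y)\ge f(x-e_i+e_j)+f(y+e_i-e_j)$, where $e_i$ is the $i$th unit vector. 5. $f$ is M-convex: $f$ is M$^\natural$-convex and $S=\operatorname{dom} f$ is an M-convex set, i.e. for all $x,y\in S$ and every $i$ with $x_i>y_i$ there is $j$ with $x_j<y_j$ such that $x-e_i+e_j\in S$ and $y+e_i-e_j\in S$. 6. $f$ is multimodular: the function $(x_0,x_1,\dots,x_n)\mapsto f(x_1-x_0,\,x_2-x_1,\,\dots,\,x_n-x_{n-1})$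 on $\mathbb{Z}^{n+1}$ is submodular. 7. $f$ is globally discrete midpoint convex: $(*)$ holds for all $x,y\in\mathbb{Z}^n$ with $\|x-y\|_\infty\ge 2$. 8. $f$ is locally discrete midpoint convex: $S=\operatorname{dom} f$ is a discrete midpoint convex set, i.e. $\left\lceil\frac{x+y}{2}\right\rceil,\left\lfloor\frac{x+y}{2}\right\rfloor\in S$ for all $x,y\in S$ with $\|x-y\|_\infty\ge 2$, and $(*)$ holds for all $x,y\in\mathbb{Z}^n$ with $\|x-y\|_\infty=2$. -/

import Mathlib

namespace DiscreteConvex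

/-- The effective domain `{x ∈ ℤⁿ | f x < +∞}` of `f : ℤⁿ → ℝ ∪ {+∞}`. -/
def effDom {n : ℕ} (f : (Fin n → ℤ) → WithTop ℝ) : Set (Fin n → ℤ) :=
  {x | f x < ⊤}

/-- `f : ℤⁿ → ℝ ∪ {+∞}` takes values in `ℤ ∪ {+∞}`. -/
def IsIntegerValued {n : ℕ} (f : (Fin n → ℤ) → WithTop ℝ) : Prop :=
  ∀ x, f x = ⊤ ∨ ∃ k : ℤ, f x = (((k : ℝ)) : WithTop ℝ)

/-! ### Separable convexity -/

/-- Discrete convexity of a univariate function `φ : ℤ → ℝ ∪ {+∞}`: the effective domain is an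
interval of integers, and `φ (t - 1) + φ (t + 1) ≥ 2 φ t` for all `t`. -/
def IsUnivariateConvex (φ : ℤ → WithTop ℝ) : Prop :=
  {t : ℤ | φ t < ⊤}.OrdConnected ∧ ∀ t : ℤ, φ t + φ t ≤ φ (t - 1) + φ (t + 1)

/-- `f x = φ₁ x₁ + ⋯ + φₙ xₙ` with univariate discrete convex functions `φᵢ`. -/
def IsSeparableConvex {n : ℕ} (f : (Fin n → ℤ) → WithTop ℝ) : Prop :=
  ∃ φ : Fin n → ℤ → WithTop ℝ,
    (∀ i, IsUnivariateConvex (φ i)) ∧ ∀ x, f x = ∑ i, φ i (x i)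

/-! ### L-convexity and discrete midpoint convexity -/

/-- `⌈(x + y) / 2⌉`, rounding up componentwise. -/
def midCeil {n : ℕ} (x y : Fin n → ℤ) : Fin n → ℤ :=
  fun i => ⌈((x i : ℚ) + (y i : ℚ)) / 2⌉

/-- `⌊(x + y) / 2⌋`, rounding down componentwise. -/
def midFloor {n : ℕ} (x y : Fin n → ℤ) : Fin n → ℤ :=
  fun i => ⌊((x i : ℚ) + (y i : ℚ)) / 2⌋

/-- The discrete midpoint inequality of `f` for the pair `(x, y)`. -/
def MidpointIneq {n : ℕ} (f : (Fin n → ℤ) → WithTop ℝ) (x y : Fin n → ℤ) : Prop :=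
  f (midCeil x y) + f (midFloor x y) ≤ f x + f y

/-- L♮-convex functions. -/
def IsLNaturalConvex {n : ℕ} (f : (Fin n → ℤ) → WithTop ℝ) : Prop :=
  (effDom f).Nonempty ∧ ∀ x y, MidpointIneq f x y

/-- Submodularity on `ℤⁿ`; `⊔` and `⊓` are the componentwise maximum and minimum. -/
def IsSubmodular {n : ℕ} (f : (Fin n → ℤ) → WithTop ℝ) : Prop :=
  ∀ x y, f (x ⊔ y) + f (x ⊓ y) ≤ f x + f y

/-- L-convex functions: submodular, and linear in the direction `(1, …, 1)`. -/
def IsLConvex {n : ℕ} (f : (Fin n → ℤ) → WithTop ℝ) : Prop :=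
  (effDom f).Nonempty ∧ IsSubmodular f ∧ ∃ r : ℝ, ∀ x, f (x + 1) = f x + (r : WithTop ℝ)

/-- Discrete midpoint convex sets; `‖·‖` on `Fin n → ℤ` is the `ℓ_∞`-norm. -/
def IsDiscreteMidpointConvexSet {n : ℕ} (S : Set (Fin n → ℤ)) : Prop :=
  S.Nonempty ∧ ∀ x ∈ S, ∀ y ∈ S, 2 ≤ ‖x - y‖ → midCeil x y ∈ S ∧ midFloor x y ∈ S

/-- Globally discrete midpoint convex functions. -/
def IsGloballyDMC {n : ℕ} (f : (Fin n → ℤ) → WithTop ℝ) : Prop :=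
  (effDom f).Nonempty ∧ ∀ x y, 2 ≤ ‖x - y‖ → MidpointIneq f x y

/-- Locally discrete midpoint convex functions. -/
def IsLocallyDMC {n : ℕ} (f : (Fin n → ℤ) → WithTop ℝ) : Prop :=
  IsDiscreteMidpointConvexSet (effDom f) ∧ ∀ x y, ‖x - y‖ = 2 → MidpointIneq f x y

/-! ### M-convexity -/

/-- The unit vector `eᵢ` of `ℤⁿ`. -/
def unitVec {n : ℕ} (i : Fin n) : Fin n → ℤ := Pi.single i 1

/-- M♮-convex functions, by the exchange property. -/
def IsMNaturalConvex {n : ℕ} (f : (Fin n → ℤ) → WithTop ℝ) : Prop :=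
  (effDom f).Nonempty ∧ ∀ x y : Fin n → ℤ, ∀ i, y i < x i →
    (f (x - unitVec i) + f (y + unitVec i) ≤ f x + f y ∨
      ∃ j, x j < y j ∧
        f (x - unitVec i + unitVec j) + f (y + unitVec i - unitVec j) ≤ f x + f y)

/-- M-convex sets, by the exchange property. -/
def IsMConvexSet {n : ℕ} (S : Set (Fin n → ℤ)) : Prop :=
  S.Nonempty ∧ ∀ x ∈ S, ∀ y ∈ S, ∀ i, y i < x i →
    ∃ j, x j < y j ∧ x - unitVec i + unitVec j ∈ S ∧ y + unitVec i - unitVec j ∈ S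

/-- M-convex functions: M♮-convex functions whose effective domain is an M-convex set. -/
def IsMConvex {n : ℕ} (f : (Fin n → ℤ) → WithTop ℝ) : Prop :=
  IsMNaturalConvex f ∧ IsMConvexSet (effDom f)

/-! ### Multimodularity -/

/-- Multimodular functions: the function
`(x₀, x₁, …, xₙ) ↦ f (x₁ - x₀, x₂ - x₁, …, xₙ - xₙ₋₁)` is submodular in `n + 1` variables. -/
def IsMultimodular {n : ℕ} (f : (Fin n → ℤ) → WithTop ℝ) : Prop :=
  (effDom f).Nonempty ∧
    IsSubmodular (fun x : Fin (n + 1) → ℤ => f (fun i => x i.succ - x i.castSucc))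

/-! ### Integral conjugation -/

/-- The inclusion of `ℝ ∪ {+∞}` into `[-∞, +∞]`. -/
noncomputable def toEReal : WithTop ℝ → EReal
  | ⊤ => ⊤
  | (r : ℝ) => (r : EReal)

/-- The integral conjugate `p ↦ sup {⟨p, x⟩ - g x | x ∈ ℤⁿ}` (`p ∈ ℤⁿ`) of a function `g` on `ℤⁿ`.
The supremum is taken in `[-∞, +∞]`; if `g` takes values in `ℤ ∪ {+∞}` and is somewhere finite,
so that the supremum is one of integers and `-∞`, it lies in `ℤ ∪ {+∞}`. -/
noncomputable def integralConjugate {n : ℕ} (g : (Fin n → ℤ) → EReal) :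
    (Fin n → ℤ) → EReal :=
  fun p => ⨆ x : Fin n → ℤ, (((∑ i, p i * x i : ℤ) : ℝ) : EReal) - g x

/-- The integral biconjugate of `f : ℤⁿ → ℝ ∪ {+∞}`. -/
noncomputable def integralBiconjugate {n : ℕ} (f : (Fin n → ℤ) → WithTop ℝ) :
    (Fin n → ℤ) → EReal :=
  integralConjugate (integralConjugate (fun x => toEReal (f x)))

/-- `f•• = f`, as functions on all of `ℤⁿ`. -/
def EqIntegralBiconjugate {n : ℕ} (f : (Fin n → ℤ) → WithTop ℝ) : Prop :=
  ∀ x, integralBiconjugate f x = toEReal (f x)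

end DiscreteConvex

open DiscreteConvex

/-!
The argument extracts from each class one property, `IsRoundedMidpointConvex`: two points `x`, `y`
of `dom f` can be replaced by two points `u`, `v` with `u + v = x + y` and `‖u - v‖_∞ ≤ 1`, that is,
by two roundings of their midpoint, inside `dom f` in general and with `f u + f v ≤ f x + f y` if
`‖x - y‖_∞ ≤ 2`. It is insensitive to adding linear functions, because the sums agree.

Locally discrete midpoint convex functions have this property by definition, and they include the
L♮-convex and the globally discrete midpoint convex ones. For separable convex, L-convex and
M♮-convex functions the defining inequality brings `x` and `y` closer in `ℓ₁`-distance as long as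
some coordinates differ by at least `2` (`isRoundedMidpointConvex_of_reduction`). A multimodular
function is the pullback of an L-convex function along an integral linear map.

The property yields an integral subgradient at each point `x₀` of `dom f`
(`exists_int_subgradient`):
* On the cube `x₀ + {-1, 0, 1}ⁿ` a solution `p` is found one coordinate at a time. The coordinate
  being chosen occurs with coefficients `±1`, so its bounds are integers, and two conflicting bounds
  would come from `y`, `z` whose midpoint roundings `u`, `v` have that coordinate equal to the one
  of `x₀` and violate an inequality that already holds.
* A local minimum of `f - p` is a global one: on a path from `x₀` in `dom f` with steps in the unit
  cube and minimal total value, the values form a convex sequence.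

The `ℓ₁`-distance to `dom f` has the property too, on all of `ℤⁿ`. Its integral subgradient at a
point outside `dom f` strictly separates that point from `dom f` (`exists_int_separation`), and
adding multiples of it to a subgradient of `f` gives integral affine minorants of `f` with
arbitrarily large value at the point. Hence `f` is the supremum of its integral affine minorants,
which is the assertion `f•• = f`.
-/

namespace DiscreteConvex

variable {n : ℕ}

/-! ### Subgradients from balanced midpoints -/

/-- The `ℓ_∞`-distance of `x` and `y` is at most `1`. -/
def Near (x y : Fin n → ℤ) : Prop := ∀ i, |x i - y i| ≤ 1

/-- Any two points of `S` can be replaced by two points of `S` with the same sum that are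
`Near`, that is, by two roundings of the midpoint. -/
def HasMidpoints (S : Set (Fin n → ℤ)) : Prop :=
  ∀ x ∈ S, ∀ y ∈ S, ∃ u ∈ S, ∃ v ∈ S, u + v = x + y ∧ Near u v

/-- Two points of `S` at `ℓ_∞`-distance at most `2` can be replaced by two points of `S` with the
same sum that are `Near`, without increasing the sum of the values of `F`. -/
def HasLocalMidpoints (S : Set (Fin n → ℤ)) (F : (Fin n → ℤ) → ℤ) : Prop :=
  ∀ x ∈ S, ∀ y ∈ S, (∀ i, |x i - y i| ≤ 2) →
    ∃ u ∈ S, ∃ v ∈ S, u + v = x + y ∧ Near u v ∧ F u + F v ≤ F x + F y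

/-- A function with local midpoints still has them after an affine function is subtracted, as the
two pairs have the same sum. -/
lemma HasLocalMidpoints.sub_affine {S : Set (Fin n → ℤ)} {F : (Fin n → ℤ) → ℤ}
    (h : HasLocalMidpoints S F) (a : ℤ) (p x₀ : Fin n → ℤ) :
    HasLocalMidpoints S (fun y => F y - a - ∑ i, p i * (y i - x₀ i)) := by
  intro x hx y hy hxy
  obtain ⟨u, hu, v, hv, huv, hn, hle⟩ := h x hx y hy hxy
  refine ⟨u, hu, v, hv, huv, hn, ?_⟩
  have key : ∑ i, p i * (u i - x₀ i) + ∑ i, p i * (v i - x₀ i)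
      = ∑ i, p i * (x i - x₀ i) + ∑ i, p i * (y i - x₀ i) := by
    rw [← Finset.sum_add_distrib, ← Finset.sum_add_distrib]
    refine Finset.sum_congr rfl fun i _ => ?_
    have := congrFun huv i
    simp only [Pi.add_apply] at this
    linear_combination p i * this
  simp only
  linarith

/-- An integer separates two finite sets of integers, one of which lies below the other. -/
lemma exists_int_between {A B : Set ℤ} (hA : A.Finite) (hB : B.Finite)
    (h : ∀ a ∈ A, ∀ b ∈ B, a ≤ b) : ∃ t, (∀ a ∈ A, a ≤ t) ∧ ∀ b ∈ B, t ≤ b := by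
  rcases A.eq_empty_or_nonempty with rfl | hne
  · obtain ⟨t, ht⟩ := hB.bddBelow
    exact ⟨t, by simp, fun b hb => ht hb⟩
  · obtain ⟨t, htA, ht⟩ := Set.exists_max_image A id hA hne
    exact ⟨t, ht, h t htA⟩

lemma finite_near (x : Fin n → ℤ) : {y | Near x y}.Finite := by
  refine (Set.finite_Icc (x - 1) (x + 1)).subset fun y hy => ?_
  constructor <;> intro i <;> have := abs_le.1 (hy i) <;> simp <;> omega

/-- Coordinatewise elimination: the inequalities that define the subgradients at `x₀`, restricted
to the points that are `Near x₀`, are solved for one coordinate of `p` after the other. The lower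
and upper bounds on the new coordinate are integers, and by the midpoint property they are
compatible as soon as the inequalities not involving this coordinate hold. -/
lemma exists_subgradient_on_coords {S : Set (Fin n → ℤ)} {F : (Fin n → ℤ) → ℤ}
    (hF : HasLocalMidpoints S F) (x₀ : Fin n → ℤ) (T : Finset (Fin n)) :
    ∃ p : Fin n → ℤ, ∀ y ∈ S, Near x₀ y → (∀ i ∉ T, y i = x₀ i) →
      0 ≤ F y - F x₀ - ∑ i, p i * (y i - x₀ i) := by
  classical
  induction T using Finset.induction_on with
  | empty =>
    refine ⟨0, fun y _ _ h => ?_⟩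
    have : y = x₀ := funext fun i => h i (by simp)
    simp [this]
  | insert k T hk ih =>
    obtain ⟨p, hp⟩ := ih
    set G : (Fin n → ℤ) → ℤ := fun y => F y - F x₀ - ∑ i, p i * (y i - x₀ i) with hG
    have hGm : HasLocalMidpoints S G := hF.sub_affine _ p x₀
    let U : ℤ → Set (Fin n → ℤ) := fun δ =>
      {y | Near x₀ y ∧ y ∈ S ∧ (∀ i ∉ insert k T, y i = x₀ i) ∧ y k = x₀ k + δ}
    have hU : ∀ δ, (U δ).Finite := fun δ => (finite_near x₀).subset fun y hy => hy.1
    -- `y` and `z` bound `t` from below and above; the roundings `u`, `v` of their midpoint have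
    -- `k`-th coordinate `x₀ k`, so the inequalities for `T` apply to them
    obtain ⟨t, ht1, ht2⟩ := exists_int_between ((hU (-1)).image fun y => -G y)
      ((hU 1).image G) (by
        rintro _ ⟨y, ⟨hny, hyS, hyT, hyk⟩, rfl⟩ _ ⟨z, ⟨hnz, hzS, hzT, hzk⟩, rfl⟩
        obtain ⟨u, hu, v, hv, huv, hn, hle⟩ := hGm y hyS z hzS (fun i => by
          have := abs_le.1 (hny i); have := abs_le.1 (hnz i); rw [abs_le]; omega)
        have hi : ∀ i, u i + v i = y i + z i := fun i => congrFun huv i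
        have h1 : 0 ≤ G u := hp u hu (fun i => by
            have := abs_le.1 (hny i); have := abs_le.1 (hnz i); have := abs_le.1 (hn i)
            have := hi i
            rw [abs_le]; omega) (fun i hiT => by
            have := hi i; have := abs_le.1 (hn i)
            by_cases hik : i = k
            · subst hik; omega
            · have := hyT i (by simp [hik, hiT]); have := hzT i (by simp [hik, hiT]); omega)
        have h2 : 0 ≤ G v := hp v hv (fun i => by
            have := abs_le.1 (hny i); have := abs_le.1 (hnz i); have := abs_le.1 (hn i)
            have := hi i
            rw [abs_le]; omega) (fun i hiT => by
            have := hi i; have := abs_le.1 (hn i)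
            by_cases hik : i = k
            · subst hik; omega
            · have := hyT i (by simp [hik, hiT]); have := hzT i (by simp [hik, hiT]); omega)
        linarith)
    refine ⟨p + Pi.single k t, fun y hyS hny hyT => ?_⟩
    have hsum : ∑ i, (p + Pi.single k t : Fin n → ℤ) i * (y i - x₀ i)
        = ∑ i, p i * (y i - x₀ i) + t * (y k - x₀ k) := by
      simp only [Pi.add_apply, add_mul, Finset.sum_add_distrib]
      congr 1
      rw [Finset.sum_eq_single k]
      · simp
      · intro i _ hik; simp [hik]
      · simp
    have hGy : F y - F x₀ - ∑ i, (p + Pi.single k t : Fin n → ℤ) i * (y i - x₀ i)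
        = G y - t * (y k - x₀ k) := by rw [hsum, hG]; ring
    rw [hGy]
    have hyk := abs_le.1 (hny k)
    obtain h | h | h : y k = x₀ k + (-1) ∨ y k = x₀ k ∨ y k = x₀ k + 1 := by omega
    · have := ht1 _ ⟨y, ⟨hny, hyS, hyT, h⟩, rfl⟩
      rw [h]; simp only at this; linarith
    · have : 0 ≤ G y := hp y hyS hny fun i hi => by
        by_cases hik : i = k
        · rw [hik, h]
        · exact hyT i (by simp [hik, hi])
      rw [h]; linarith
    · have := ht2 _ ⟨y, ⟨hny, hyS, hyT, h⟩, rfl⟩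
      rw [h]; linarith

/-- The points `c 0, …, c M` form a path from `x` to `y` in `S` with steps of `ℓ_∞`-length at
most `1`. -/
def IsStepPath (S : Set (Fin n → ℤ)) (x y : Fin n → ℤ) (M : ℕ) (c : ℕ → Fin n → ℤ) : Prop :=
  c 0 = x ∧ c M = y ∧ (∀ k ≤ M, c k ∈ S) ∧ ∀ k < M, Near (c k) (c (k + 1))

lemma IsStepPath.trans {S : Set (Fin n → ℤ)} {x y z : Fin n → ℤ} {M N : ℕ}
    {c d : ℕ → Fin n → ℤ} (hc : IsStepPath S x y M c) (hd : IsStepPath S y z N d) :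
    IsStepPath S x z (M + N) (fun k => if k ≤ M then c k else d (k - M)) := by
  obtain ⟨c0, cM, cS, cn⟩ := hc
  obtain ⟨d0, dN, dS, dn⟩ := hd
  refine ⟨by simp [c0], ?_, ?_, ?_⟩
  · rcases N.eq_zero_or_pos with rfl | hN
    · simp [cM, ← dN, d0]
    · simp [hN.ne', dN]
  · intro k hk
    by_cases h : k ≤ M
    · simpa [h] using cS k h
    · simpa [h] using dS (k - M) (by omega)
  · intro k hk
    rcases lt_trichotomy k M with h | rfl | h
    · simpa [h.le, Nat.succ_le_of_lt h] using cn k h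
    · have := dn 0 (by omega)
      simpa [cM, ← d0] using this
    · have := dn (k - M) (by omega)
      have e : k + 1 - M = k - M + 1 := by omega
      simpa [not_le.2 h, not_le.2 (h.trans (Nat.lt_succ_self k)), e,
        show ¬ k + 1 ≤ M by omega] using this

/-- Repeated bisection connects any two points of a set with midpoints. -/
lemma HasMidpoints.exists_isStepPath {S : Set (Fin n → ℤ)} (hS : HasMidpoints S)
    {x y : Fin n → ℤ} (hx : x ∈ S) (hy : y ∈ S) : ∃ M c, IsStepPath S x y M c := by
  have main : ∀ m : ℕ, ∀ x ∈ S, ∀ y ∈ S, (∀ i, |x i - y i| ≤ m) →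
      ∃ M c, IsStepPath S x y M c := by
    intro m
    induction m using Nat.strong_induction_on with
    | _ m ih =>
      intro x hx y hy hxy
      by_cases hm : m ≤ 1
      · refine ⟨1, fun k => if k = 0 then x else y, by simp, by simp, ?_, ?_⟩
        · intro k _; by_cases h : k = 0 <;> simp [h, hx, hy]
        · intro k hk i
          obtain rfl : k = 0 := by omega
          have := hxy i
          simp only [if_true, Nat.zero_add, one_ne_zero, if_false]
          exact this.trans (by exact_mod_cast hm)
      · obtain ⟨u, hu, v, hv, huv, hn⟩ := hS x hx y hy
        have hi : ∀ i, u i + v i = x i + y i := fun i => congrFun huv i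
        obtain ⟨M, c, hc⟩ := ih (m - 1) (by omega) x hx u hu (fun i => by
          have := abs_le.1 (hxy i); have := abs_le.1 (hn i); have := hi i
          rw [abs_le]; omega)
        obtain ⟨N, d, hd⟩ := ih (m - 1) (by omega) u hu y hy (fun i => by
          have := abs_le.1 (hxy i); have := abs_le.1 (hn i); have := hi i
          rw [abs_le]; omega)
        exact ⟨_, _, hc.trans hd⟩
  refine main (∑ i, (x i - y i).natAbs) x hx y hy fun i => ?_
  rw [Int.abs_eq_natAbs]
  exact_mod_cast Finset.single_le_sum (f := fun i => (x i - y i).natAbs)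
    (fun _ _ => Nat.zero_le _) (Finset.mem_univ i)

lemma IsStepPath.abs_sub_le {S : Set (Fin n → ℤ)} {x y : Fin n → ℤ} {M : ℕ}
    {c : ℕ → Fin n → ℤ} (hc : IsStepPath S x y M c) (i : Fin n) :
    ∀ k ≤ M, |c k i - x i| ≤ k := by
  intro k
  induction k with
  | zero => simp [hc.1]
  | succ k ih =>
    intro hk
    have h1 := abs_le.1 (ih (by omega))
    have h2 := abs_le.1 (hc.2.2.2 k (by omega) i)
    rw [abs_le]; push_cast; omega

/-- Among the paths of a given length from `x` to `y` in `S`, one minimizes the sum of the values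
of `h`, because these paths stay in a finite box. -/
lemma IsStepPath.exists_min {S : Set (Fin n → ℤ)} {x y : Fin n → ℤ} {M : ℕ}
    {c : ℕ → Fin n → ℤ} (hc : IsStepPath S x y M c) (h : (Fin n → ℤ) → ℤ) :
    ∃ c', IsStepPath S x y M c' ∧ ∀ d, IsStepPath S x y M d →
      ∑ k ∈ Finset.range (M + 1), h (c' k) ≤ ∑ k ∈ Finset.range (M + 1), h (d k) := by
  let R : Fin n → ℤ := fun _ => M
  obtain ⟨b, hb⟩ := ((Set.finite_Icc (x - R) (x + R)).image h).bddBelow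
  obtain ⟨m, ⟨c', hc', rfl⟩, hmin⟩ := Int.exists_least_of_bdd
    (P := fun s => ∃ d, IsStepPath S x y M d ∧ ∑ k ∈ Finset.range (M + 1), h (d k) = s)
    ⟨∑ _k ∈ Finset.range (M + 1), b, by
      rintro _ ⟨d, hd, rfl⟩
      refine Finset.sum_le_sum fun k hk => hb ⟨d k, ?_, rfl⟩
      have hk : k ≤ M := Nat.lt_succ_iff.1 (Finset.mem_range.1 hk)
      constructor <;> intro i <;> have := abs_le.1 (hd.abs_sub_le i k hk) <;>
        simp [R] <;> omega⟩
    ⟨_, c, hc, rfl⟩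
  exact ⟨c', hc', fun d hd => hmin _ ⟨d, hd, rfl⟩⟩

/-- A local minimum is a global minimum: the values along a path of minimal total value form a
convex sequence, because each interior vertex may be replaced by a midpoint of its neighbours. -/
lemma nonneg_of_nonneg_near {S : Set (Fin n → ℤ)} {h : (Fin n → ℤ) → ℤ}
    (hS : HasMidpoints S) (hh : HasLocalMidpoints S h) {x₀ : Fin n → ℤ} (hx₀ : x₀ ∈ S)
    (h0 : h x₀ = 0) (hnear : ∀ y ∈ S, Near x₀ y → 0 ≤ h y) : ∀ y ∈ S, 0 ≤ h y := by
  intro y hy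
  obtain ⟨M, c₁, hc₁⟩ := hS.exists_isStepPath hx₀ hy
  obtain ⟨c, ⟨c0, cM, cS, cn⟩, hmin⟩ := hc₁.exists_min h
  -- replacing the vertex `c (k + 1)` by `u` gives another path, whose total value is not smaller
  have replace_le : ∀ k, k + 2 ≤ M → ∀ u ∈ S, Near (c k) u → Near u (c (k + 2)) →
      h (c (k + 1)) ≤ h u := by
    intro k hk u hu hku huk
    have hpath : IsStepPath S x₀ y M (Function.update c (k + 1) u) := by
      refine ⟨by simp [c0], by rw [Function.update_of_ne (by omega), cM], ?_, ?_⟩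
      · intro j hj
        by_cases e : j = k + 1
        · subst e; simpa using hu
        · rw [Function.update_of_ne e]; exact cS j hj
      · intro j hj
        by_cases e : j = k + 1
        · subst e
          rw [Function.update_self, Function.update_of_ne (by omega)]; exact huk
        · by_cases e' : j = k
          · subst e'
            rw [Function.update_self, Function.update_of_ne (by omega)]; exact hku
          · rw [Function.update_of_ne e, Function.update_of_ne (by omega)]; exact cn j hj
    have hle := hmin _ hpath
    have hmem : k + 1 ∈ Finset.range (M + 1) := by simp; omega
    rw [← Finset.add_sum_erase _ _ hmem, ← Finset.add_sum_erase _ (fun j => h _) hmem,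
      Function.update_self] at hle
    have : ∑ j ∈ (Finset.range (M + 1)).erase (k + 1), h (Function.update c (k + 1) u j)
        = ∑ j ∈ (Finset.range (M + 1)).erase (k + 1), h (c j) :=
      Finset.sum_congr rfl fun j hj => by
        rw [Function.update_of_ne (Finset.ne_of_mem_erase hj)]
    linarith
  have hconv : ∀ k, k + 2 ≤ M → 2 * h (c (k + 1)) ≤ h (c k) + h (c (k + 2)) := by
    intro k hk
    have hk1 := cn k (by omega)
    have hk2 := cn (k + 1) (by omega)
    have hd : ∀ i, |c k i - c (k + 2) i| ≤ 2 := fun i => by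
      have := abs_le.1 (hk1 i); have := abs_le.1 (hk2 i); rw [abs_le]
      simp only [Nat.add_assoc, Nat.reduceAdd] at *
      omega
    obtain ⟨u, hu, v, hv, huv, hn, hle⟩ := hh _ (cS k (by omega)) _ (cS (k + 2) hk) hd
    have hi : ∀ i, u i + v i = c k i + c (k + 2) i := fun i => congrFun huv i
    have h1 := replace_le k hk u hu
      (fun i => by
        have := abs_le.1 (hd i); have := abs_le.1 (hn i); have := hi i
        rw [abs_le]; omega)
      (fun i => by
        have := abs_le.1 (hd i); have := abs_le.1 (hn i); have := hi i
        rw [abs_le]; omega)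
    have h2 := replace_le k hk v hv
      (fun i => by
        have := abs_le.1 (hd i); have := abs_le.1 (hn i); have := hi i
        rw [abs_le]; omega)
      (fun i => by
        have := abs_le.1 (hd i); have := abs_le.1 (hn i); have := hi i
        rw [abs_le]; omega)
    linarith
  have hmono : ∀ k, k + 1 ≤ M → h (c k) ≤ h (c (k + 1)) := by
    intro k
    induction k with
    | zero =>
      intro hk
      rw [c0, h0]
      exact hnear _ (cS 1 hk) (c0 ▸ cn 0 (by omega))
    | succ k ih =>
      intro hk
      have := ih (by omega)
      have := hconv k (by omega)
      simp only [Nat.add_assoc, Nat.reduceAdd] at *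
      linarith
  have hpos : ∀ k ≤ M, 0 ≤ h (c k) := by
    intro k
    induction k with
    | zero => intro _; rw [c0, h0]
    | succ k ih => intro hk; exact (ih (by omega)).trans (hmono k hk)
  exact cM ▸ hpos M le_rfl

theorem exists_int_subgradient {S : Set (Fin n → ℤ)} {F : (Fin n → ℤ) → ℤ}
    (hS : HasMidpoints S) (hF : HasLocalMidpoints S F) {x₀ : Fin n → ℤ} (hx₀ : x₀ ∈ S) :
    ∃ p : Fin n → ℤ, ∀ y ∈ S, F x₀ + ∑ i, p i * (y i - x₀ i) ≤ F y := by
  obtain ⟨p, hp⟩ := exists_subgradient_on_coords hF x₀ Finset.univ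
  refine ⟨p, fun y hy => ?_⟩
  have := nonneg_of_nonneg_near hS (hF.sub_affine (F x₀) p x₀) hx₀ (by simp)
    (fun y hy hn => hp y hy hn (by simp)) y hy
  linarith

/-! ### Separation of a point from a set with midpoints -/

/-- The `ℓ₁`-distance on `ℤⁿ`. -/
def l1 (x y : Fin n → ℤ) : ℕ := ∑ i, (x i - y i).natAbs

/-- The `ℓ₁`-distance from `x` to `S` (for nonempty `S`). -/
noncomputable def l1Dist (S : Set (Fin n → ℤ)) (x : Fin n → ℤ) : ℕ := sInf (l1 x '' S)

lemma l1Dist_le {S : Set (Fin n → ℤ)} {y : Fin n → ℤ} (hy : y ∈ S) (x : Fin n → ℤ) :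
    l1Dist S x ≤ l1 x y := Nat.sInf_le ⟨y, hy, rfl⟩

lemma exists_l1_eq_l1Dist {S : Set (Fin n → ℤ)} (hne : S.Nonempty) (x : Fin n → ℤ) :
    ∃ y ∈ S, l1 x y = l1Dist S x := Nat.sInf_mem (hne.image _)

lemma hasMidpoints_univ : HasMidpoints (Set.univ : Set (Fin n → ℤ)) := by
  intro x _ y _
  refine ⟨fun i => (x i + y i) / 2, trivial, fun i => x i + y i - (x i + y i) / 2, trivial,
    ?_, ?_⟩
  · ext i; simp
  · intro i; simp only [abs_le]; omega

/-- The roundings of the midpoint of `x` and `y` are ordered in each coordinate like the roundings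
`w₁`, `w₂` of the midpoint of the points of `S` nearest to `x` and `y`. -/
lemma hasLocalMidpoints_l1Dist {S : Set (Fin n → ℤ)} (hne : S.Nonempty) (hS : HasMidpoints S) :
    HasLocalMidpoints Set.univ (fun x => (l1Dist S x : ℤ)) := by
  intro x _ y _ _
  obtain ⟨a, ha, hxa⟩ := exists_l1_eq_l1Dist hne x
  obtain ⟨b, hb, hyb⟩ := exists_l1_eq_l1Dist hne y
  obtain ⟨w₁, hw₁, w₂, hw₂, hw, hn⟩ := hS a ha b hb
  let u : Fin n → ℤ := fun i => if w₁ i ≤ w₂ i then (x i + y i) / 2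
    else x i + y i - (x i + y i) / 2
  refine ⟨u, trivial, x + y - u, trivial, by simp, fun i => ?_, ?_⟩
  · simp only [u, Pi.sub_apply, Pi.add_apply]; rw [abs_le]; split_ifs <;> constructor <;> omega
  · have h1 := l1Dist_le hw₁ u
    have h2 := l1Dist_le hw₂ (x + y - u)
    have h3 : l1 u w₁ + l1 (x + y - u) w₂ ≤ l1 x a + l1 y b := by
      simp only [l1, ← Finset.sum_add_distrib]
      refine Finset.sum_le_sum fun i _ => ?_
      have := abs_le.1 (hn i)
      have : w₁ i + w₂ i = a i + b i := congrFun hw i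
      simp only [u, Pi.sub_apply, Pi.add_apply]
      split_ifs <;> omega
    simp only
    omega

/-- The separating vector is a subgradient of the `ℓ₁`-distance to `S`. -/
theorem exists_int_separation {S : Set (Fin n → ℤ)} (hne : S.Nonempty) (hS : HasMidpoints S)
    {x : Fin n → ℤ} (hx : x ∉ S) :
    ∃ q : Fin n → ℤ, ∀ y ∈ S, 1 + ∑ i, q i * (y i - x i) ≤ 0 := by
  obtain ⟨q, hq⟩ := exists_int_subgradient hasMidpoints_univ (hasLocalMidpoints_l1Dist hne hS)
    (Set.mem_univ x)
  refine ⟨q, fun y hy => ?_⟩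
  have h1 := hq y trivial
  have h2 : l1Dist S y = 0 := by
    have := l1Dist_le hy y
    simpa [l1] using this
  have h3 : 1 ≤ l1Dist S x := by
    obtain ⟨a, ha, hxa⟩ := exists_l1_eq_l1Dist hne x
    rw [← hxa, Nat.one_le_iff_ne_zero]
    intro h0
    refine hx ?_
    have : x = a := funext fun i => by
      have := (Finset.sum_eq_zero_iff.1 h0) i (Finset.mem_univ i)
      omega
    rwa [this]
  rw [h2] at h1
  push_cast at h1
  linarith [show (1 : ℤ) ≤ l1Dist S x by exact_mod_cast h3]

/-! ### From integral affine minorants to the biconjugate -/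

/-- `f` is the supremum of its integral affine minorants: every integer `L ≤ f x` is at most the
value at `x` of some affine function with integer coefficients that is below `f`. -/
def HasIntegralMinorants (f : (Fin n → ℤ) → WithTop ℝ) : Prop :=
  ∀ x, ∀ L : ℤ, ((L : ℝ) : WithTop ℝ) ≤ f x → ∃ (p : Fin n → ℤ) (b : ℤ),
    (∀ y, (((∑ i, p i * y i + b : ℤ) : ℝ) : WithTop ℝ) ≤ f y) ∧ L ≤ ∑ i, p i * x i + b

lemma toEReal_coe (r : ℝ) : toEReal (r : WithTop ℝ) = (r : EReal) := rfl

lemma toEReal_top : toEReal ⊤ = ⊤ := rfl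

lemma integralBiconjugate_le (f : (Fin n → ℤ) → WithTop ℝ) (x : Fin n → ℤ) :
    integralBiconjugate f x ≤ toEReal (f x) := by
  induction hfx : f x using WithTop.recTopCoe with
  | top => rw [toEReal_top]; exact le_top
  | coe r =>
    refine iSup_le fun p => ?_
    have h1 : (((∑ i, p i * x i : ℤ) : ℝ) : EReal) - (r : EReal)
        ≤ integralConjugate (fun x => toEReal (f x)) p := by
      refine le_trans (le_of_eq ?_) (le_iSup (fun x : Fin n → ℤ =>
        (((∑ i, p i * x i : ℤ) : ℝ) : EReal) - toEReal (f x)) x)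
      simp only [hfx, toEReal_coe]
    have h2 : (∑ i, x i * p i) = ∑ i, p i * x i := Finset.sum_congr rfl fun i _ => mul_comm _ _
    rw [h2]
    refine (EReal.sub_le_sub le_rfl h1).trans ?_
    rw [toEReal_coe, ← EReal.coe_sub, ← EReal.coe_sub, sub_sub_cancel]

lemma le_integralBiconjugate {f : (Fin n → ℤ) → WithTop ℝ} {p : Fin n → ℤ} {b : ℤ}
    (h : ∀ y, (((∑ i, p i * y i + b : ℤ) : ℝ) : WithTop ℝ) ≤ f y) (x : Fin n → ℤ) :
    (((∑ i, p i * x i + b : ℤ) : ℝ) : EReal) ≤ integralBiconjugate f x := by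
  have h1 : integralConjugate (fun x => toEReal (f x)) p ≤ ((-b : ℝ) : EReal) := by
    refine iSup_le fun y => ?_
    have hy := h y
    induction hfy : f y using WithTop.recTopCoe with
    | top => simp only [hfy, toEReal_top, EReal.sub_top, bot_le]
    | coe r =>
      rw [hfy, WithTop.coe_le_coe] at hy
      simp only [hfy]
      rw [toEReal_coe, ← EReal.coe_sub, EReal.coe_le_coe_iff]
      push_cast at hy ⊢
      linarith
  refine le_trans ?_ (le_iSup (fun q : Fin n → ℤ => (((∑ i, x i * q i : ℤ) : ℝ) : EReal) -
    integralConjugate (fun x => toEReal (f x)) q) p)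
  refine le_trans (le_of_eq ?_) (EReal.sub_le_sub le_rfl h1)
  have h2 : (∑ i, x i * p i) = ∑ i, p i * x i := Finset.sum_congr rfl fun i _ => mul_comm _ _
  rw [h2, ← EReal.coe_sub, Int.cast_add, sub_neg_eq_add]

theorem HasIntegralMinorants.eqIntegralBiconjugate {f : (Fin n → ℤ) → WithTop ℝ}
    (hint : IsIntegerValued f) (h : HasIntegralMinorants f) : EqIntegralBiconjugate f := by
  intro x
  refine le_antisymm (integralBiconjugate_le f x) ?_
  have hL : ∀ L : ℤ, ((L : ℝ) : WithTop ℝ) ≤ f x →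
      ((L : ℝ) : EReal) ≤ integralBiconjugate f x := by
    intro L hLx
    obtain ⟨p, b, hp, hpx⟩ := h x L hLx
    exact le_trans (by exact_mod_cast hpx) (le_integralBiconjugate hp x)
  rcases hint x with hx | ⟨k, hk⟩
  · have htop : integralBiconjugate f x = ⊤ := by
      rw [EReal.eq_top_iff_forall_lt]
      intro y
      obtain ⟨m, hm⟩ := exists_nat_gt y
      refine lt_of_lt_of_le ?_ (hL m (by simp [hx]))
      exact_mod_cast hm
    rw [htop]
    exact le_top
  · rw [hk, toEReal_coe]
    exact hL k hk.ge

/-- Integral affine minorants can be pulled back along a `ℤ`-linear map. -/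
lemma HasIntegralMinorants.comp_linearMap {m : ℕ} {f : (Fin m → ℤ) → WithTop ℝ}
    (h : HasIntegralMinorants f) (E : (Fin n → ℤ) →ₗ[ℤ] (Fin m → ℤ)) :
    HasIntegralMinorants (fun y => f (E y)) := by
  intro x L hL
  obtain ⟨p, b, hp, hpx⟩ := h (E x) L hL
  have key : ∀ y : Fin n → ℤ,
      ∑ i, p i * E y i = ∑ j, (∑ i, p i * E (Pi.single j 1) i) * y j := by
    intro y
    conv_lhs => rw [LinearMap.pi_apply_eq_sum_univ E y]
    simp only [Finset.sum_apply, Pi.smul_apply, smul_eq_mul, Finset.mul_sum, Finset.sum_mul]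
    rw [Finset.sum_comm]
    refine Finset.sum_congr rfl fun j _ => Finset.sum_congr rfl fun i _ => ?_
    have : (fun k => if j = k then (1 : ℤ) else 0) = Pi.single j 1 := by
      ext k; simp [Pi.single_apply, eq_comm]
    rw [this]; ring
  refine ⟨fun j => ∑ i, p i * E (Pi.single j 1) i, b, fun y => ?_, ?_⟩
  · rw [← key]; exact hp (E y)
  · rw [← key]; exact hpx

/-! ### Midpoint convexity of functions with values in `ℝ ∪ {+∞}` -/

/-- `f` satisfies a midpoint inequality, for suitable roundings `u`, `v` of the midpoint, for all
pairs of points at `ℓ_∞`-distance at most `2`, and its effective domain has midpoints. -/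
def IsRoundedMidpointConvex (f : (Fin n → ℤ) → WithTop ℝ) : Prop :=
  HasMidpoints (effDom f) ∧ ∀ x y, (∀ i, |x i - y i| ≤ 2) →
    ∃ u v, u + v = x + y ∧ Near u v ∧ f u + f v ≤ f x + f y

lemma mem_effDom_of_add_le {f : (Fin n → ℤ) → WithTop ℝ} {x y u v : Fin n → ℤ}
    (hx : x ∈ effDom f) (hy : y ∈ effDom f) (h : f u + f v ≤ f x + f y) :
    u ∈ effDom f ∧ v ∈ effDom f :=
  WithTop.add_lt_top.1 (h.trans_lt (WithTop.add_lt_top.2 ⟨hx, hy⟩))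

/-- On the effective domain the minorants come from a subgradient. Off the effective domain, a
subgradient at any point is steepened by multiples of a separating vector. -/
theorem IsRoundedMidpointConvex.hasIntegralMinorants {f : (Fin n → ℤ) → WithTop ℝ}
    (hdom : (effDom f).Nonempty) (hint : IsIntegerValued f) (hf : IsRoundedMidpointConvex f) :
    HasIntegralMinorants f := by
  have hF : ∀ x, ∃ k : ℤ, x ∈ effDom f → f x = ((k : ℝ) : WithTop ℝ) := by
    intro x
    rcases hint x with hx | ⟨k, hk⟩
    · exact ⟨0, fun h => absurd hx h.ne⟩
    · exact ⟨k, fun _ => hk⟩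
  choose F hF using hF
  obtain ⟨hS, hm⟩ := hf
  have hloc : HasLocalMidpoints (effDom f) F := by
    intro x hx y hy hxy
    obtain ⟨u, v, huv, hn, hle⟩ := hm x y hxy
    obtain ⟨hu, hv⟩ := mem_effDom_of_add_le hx hy hle
    refine ⟨u, hu, v, hv, huv, hn, ?_⟩
    rw [hF u hu, hF v hv, hF x hx, hF y hy] at hle
    exact_mod_cast hle
  have minorant : ∀ p x₀ : Fin n → ℤ, ∀ a : ℤ,
      (∀ y ∈ effDom f, a + ∑ i, p i * (y i - x₀ i) ≤ F y) →
      ∀ y, (((∑ i, p i * y i + (a - ∑ i, p i * x₀ i) : ℤ) : ℝ) : WithTop ℝ) ≤ f y := by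
    intro p x₀ a h y
    by_cases hy : y ∈ effDom f
    · have := h y hy
      simp only [mul_sub, Finset.sum_sub_distrib] at this
      rw [hF y hy, WithTop.coe_le_coe, Int.cast_le]
      linarith
    · have : f y = ⊤ := by simpa [effDom] using hy
      rw [this]; exact le_top
  intro x L hL
  by_cases hx : x ∈ effDom f
  · obtain ⟨p, hp⟩ := exists_int_subgradient hS hloc hx
    refine ⟨p, _, minorant p x (F x) hp, ?_⟩
    rw [hF x hx, WithTop.coe_le_coe, Int.cast_le] at hL
    linarith
  · obtain ⟨x₁, hx₁⟩ := hdom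
    obtain ⟨p, hp⟩ := exists_int_subgradient hS hloc hx₁
    obtain ⟨q, hq⟩ := exists_int_separation ⟨x₁, hx₁⟩ hS hx
    -- the subgradient inequality at `x₁`, written with base point `x`, has value `c` at `x`
    set c : ℤ := F x₁ + ∑ i, p i * (x i - x₁ i) with hc
    let K : ℤ := max 0 (L - c)
    refine ⟨p + K • q, _, minorant (p + K • q) x (c + K) fun y hy => ?_, ?_⟩
    · have h1 := hp y hy
      have h2 : K * (1 + ∑ i, q i * (y i - x i)) ≤ 0 :=
        mul_nonpos_of_nonneg_of_nonpos (le_max_left 0 (L - c)) (hq y hy)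
      have h3 : ∑ i, (p + K • q) i * (y i - x i)
          = ∑ i, p i * (y i - x i) + K * ∑ i, q i * (y i - x i) := by
        rw [Finset.mul_sum, ← Finset.sum_add_distrib]
        refine Finset.sum_congr rfl fun i _ => ?_
        simp only [Pi.add_apply, Pi.smul_apply, smul_eq_mul]; ring
      have h4 : ∑ i, p i * (x i - x₁ i) + ∑ i, p i * (y i - x i)
          = ∑ i, p i * (y i - x₁ i) := by
        rw [← Finset.sum_add_distrib]
        exact Finset.sum_congr rfl fun i _ => by ring
      rw [h3]
      linarith
    · have : L - c ≤ K := le_max_right _ _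
      linarith

/-- It suffices to bring every pair with a coordinate difference of at least `2` closer together
in `ℓ₁`-distance, with the same sum and without increasing the sum of the values. -/
lemma isRoundedMidpointConvex_of_reduction {f : (Fin n → ℤ) → WithTop ℝ}
    (h : ∀ x y, x ∈ effDom f → y ∈ effDom f → (∃ i, 2 ≤ x i - y i) →
      ∃ u v, u + v = x + y ∧ l1 u v < l1 x y ∧ f u + f v ≤ f x + f y) :
    IsRoundedMidpointConvex f := by
  have main : ∀ m : ℕ, ∀ x y, x ∈ effDom f → y ∈ effDom f → l1 x y = m →
      ∃ u v, u + v = x + y ∧ Near u v ∧ f u + f v ≤ f x + f y := by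
    intro m
    induction m using Nat.strong_induction_on with
    | _ m ih =>
      intro x y hx hy hm
      have step : ∀ u v, u + v = x + y → l1 u v < l1 x y → f u + f v ≤ f x + f y →
          ∃ u v, u + v = x + y ∧ Near u v ∧ f u + f v ≤ f x + f y := by
        intro u v huv hlt hle
        obtain ⟨hu, hv⟩ := mem_effDom_of_add_le hx hy hle
        obtain ⟨u', v', h1, h2, h3⟩ := ih _ (hm ▸ hlt) u v hu hv rfl
        exact ⟨u', v', h1.trans huv, h2, h3.trans hle⟩
      by_cases hn : Near x y
      · exact ⟨x, y, rfl, hn, le_rfl⟩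
      · simp only [Near, not_forall, not_le] at hn
        obtain ⟨i, hi⟩ := hn
        rcases lt_abs.1 hi with hi | hi
        · obtain ⟨u, v, huv, hlt, hle⟩ := h x y hx hy ⟨i, by omega⟩
          exact step u v huv hlt hle
        · obtain ⟨u, v, huv, hlt, hle⟩ := h y x hy hx ⟨i, by omega⟩
          refine step u v (huv.trans (add_comm _ _)) (hlt.trans_eq ?_)
            (hle.trans_eq (add_comm _ _))
          exact Finset.sum_congr rfl fun i _ => by rw [← Int.natAbs_neg]; congr 1; ring
  refine ⟨fun x hx y hy => ?_, fun x y _ => ?_⟩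
  · obtain ⟨u, v, huv, hn, hle⟩ := main _ x y hx hy rfl
    obtain ⟨hu, hv⟩ := mem_effDom_of_add_le hx hy hle
    exact ⟨u, hu, v, hv, huv, hn⟩
  · by_cases hx : x ∈ effDom f
    · by_cases hy : y ∈ effDom f
      · exact main _ x y hx hy rfl
      · have : f y = ⊤ := by simpa [effDom] using hy
        obtain ⟨u, -, v, -, huv, hn⟩ := hasMidpoints_univ x trivial y trivial
        exact ⟨u, v, huv, hn, by simp [this]⟩
    · have : f x = ⊤ := by simpa [effDom] using hx
      obtain ⟨u, -, v, -, huv, hn⟩ := hasMidpoints_univ x trivial y trivial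
      exact ⟨u, v, huv, hn, by simp [this]⟩

/-! ### Classes of discrete convex functions -/

/-- Moving `a` and `b` towards each other does not increase the sum of the values of a univariate
convex function. -/
lemma IsUnivariateConvex.add_le {φ : ℤ → WithTop ℝ} (h : IsUnivariateConvex φ) {a b : ℤ}
    (hab : 2 ≤ a - b) : φ (a - 1) + φ (b + 1) ≤ φ a + φ b := by
  obtain ⟨hoc, hc⟩ := h
  have main : ∀ d : ℕ, φ (b + d + 1) + φ (b + 1) ≤ φ (b + d + 2) + φ b := by
    intro d
    induction d with
    | zero =>
      have := hc (b + 1)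
      rw [add_sub_cancel_right, add_assoc b 1 1, add_comm (φ b)] at this
      simpa using this
    | succ d ih =>
      by_cases ha : φ (b + d + 3) = ⊤
      · have e : b + ((d + 1 : ℕ) : ℤ) + 2 = b + d + 3 := by push_cast; ring
        rw [e, ha]; simp
      by_cases hb : φ b = ⊤
      · simp [hb]
      have fin : ∀ t, b ≤ t → t ≤ b + d + 3 → ∃ r : ℝ, φ t = r := fun t h1 h2 => by
        have : φ t < ⊤ := hoc.out (Ne.lt_top hb) (Ne.lt_top ha) ⟨h1, h2⟩
        exact ⟨_, (WithTop.coe_untop _ this.ne).symm⟩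
      have hc2 := hc (b + d + 2)
      have e1 : b + (d : ℤ) + 2 - 1 = b + d + 1 := by ring
      have e2 : b + (d : ℤ) + 2 + 1 = b + d + 3 := by ring
      have e3 : b + ((d + 1 : ℕ) : ℤ) + 1 = b + d + 2 := by push_cast; ring
      have e4 : b + ((d + 1 : ℕ) : ℤ) + 2 = b + d + 3 := by push_cast; ring
      rw [e1, e2] at hc2
      rw [e3, e4]
      obtain ⟨r0, h0⟩ := fin b (by omega) (by omega)
      obtain ⟨r1, h1⟩ := fin (b + 1) (by omega) (by omega)
      obtain ⟨r2, h2⟩ := fin (b + d + 1) (by omega) (by omega)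
      obtain ⟨r3, h3⟩ := fin (b + d + 2) (by omega) (by omega)
      obtain ⟨r4, h4⟩ := fin (b + d + 3) (by omega) (by omega)
      rw [h0, h1, h2, h3] at ih
      rw [h2, h3, h4] at hc2
      rw [h0, h1, h3, h4]
      norm_cast at *
      linarith
  have := main (a - b - 2).toNat
  have e : ((a - b - 2).toNat : ℤ) = a - b - 2 := Int.toNat_of_nonneg (by omega)
  rw [e] at this
  convert this using 3 <;> ring

lemma IsSeparableConvex.isRoundedMidpointConvex {f : (Fin n → ℤ) → WithTop ℝ}
    (hf : IsSeparableConvex f) : IsRoundedMidpointConvex f := by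
  obtain ⟨φ, hφ, hsum⟩ := hf
  refine isRoundedMidpointConvex_of_reduction fun x y _ _ ⟨i, hi⟩ => ?_
  refine ⟨x - unitVec i, y + unitVec i, by ring, ?_, ?_⟩
  · refine Finset.sum_lt_sum (fun j _ => ?_) ⟨i, Finset.mem_univ i, ?_⟩
    · by_cases hj : j = i
      · subst hj; simp [unitVec]; omega
      · simp [unitVec, hj]
    · simp [unitVec]; omega
  · simp only [hsum, ← Finset.sum_add_distrib]
    refine Finset.sum_le_sum fun j _ => ?_
    by_cases hj : j = i
    · subst hj; simpa [unitVec] using (hφ j).add_le hi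
    · simp [unitVec, hj]

lemma IsMNaturalConvex.isRoundedMidpointConvex {f : (Fin n → ℤ) → WithTop ℝ}
    (hf : IsMNaturalConvex f) : IsRoundedMidpointConvex f := by
  refine isRoundedMidpointConvex_of_reduction fun x y _ _ ⟨i, hi⟩ => ?_
  rcases hf.2 x y i (by omega) with h | ⟨j, hj, h⟩
  · refine ⟨x - unitVec i, y + unitVec i, by ring, ?_, h⟩
    refine Finset.sum_lt_sum (fun k _ => ?_) ⟨i, Finset.mem_univ i, ?_⟩
    · by_cases hk : k = i
      · subst hk; simp [unitVec]; omega
      · simp [unitVec, hk]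
    · simp [unitVec]; omega
  · have hij : i ≠ j := by rintro rfl; omega
    refine ⟨x - unitVec i + unitVec j, y + unitVec i - unitVec j, by ring, ?_, h⟩
    refine Finset.sum_lt_sum (fun k _ => ?_) ⟨i, Finset.mem_univ i, ?_⟩
    · by_cases hk : k = i
      · subst hk; simp [unitVec, hij]; omega
      · by_cases hkj : k = j
        · subst hkj; simp [unitVec, hk]; omega
        · simp [unitVec, hk, hkj]
    · simp [unitVec, hij]; omega

/-- Submodularity for the pair `x - 1`, `y` brings every coordinate difference that is at least
`2` down by `2`, and only changes the sign of the others. -/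
lemma IsLConvex.isRoundedMidpointConvex {f : (Fin n → ℤ) → WithTop ℝ}
    (hf : IsLConvex f) : IsRoundedMidpointConvex f := by
  obtain ⟨-, hsub, r, hr⟩ := hf
  refine isRoundedMidpointConvex_of_reduction fun x y _ _ ⟨i, hi⟩ => ?_
  refine ⟨(x - 1) ⊔ y, x ⊓ (y + 1), ?_, ?_, ?_⟩
  · ext k; simp; omega
  · refine Finset.sum_lt_sum (fun k _ => ?_) ⟨i, Finset.mem_univ i, ?_⟩ <;> simp <;> omega
  · have h1 : f x = f (x - 1) + r := by rw [← hr, sub_add_cancel]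
    have h2 : f (x ⊓ (y + 1)) = f ((x - 1) ⊓ y) + r := by
      rw [← hr]; congr 1; ext k; simp; omega
    rw [h1, h2, ← add_assoc, add_right_comm (f (x - 1))]
    exact add_le_add_left (hsub (x - 1) y) _

lemma midCeil_apply (x y : Fin n → ℤ) (i : Fin n) : midCeil x y i = (x i + y i + 1) / 2 := by
  rw [midCeil, Int.ceil_eq_iff]
  have a1 : 2 * ((x i + y i + 1) / 2) - 2 < x i + y i := by omega
  have a2 : x i + y i ≤ 2 * ((x i + y i + 1) / 2) := by omega
  generalize (x i + y i + 1) / 2 = c at *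
  have a1' : (2 * c - 2 : ℚ) < x i + y i := by exact_mod_cast a1
  have a2' : (x i + y i : ℚ) ≤ 2 * c := by exact_mod_cast a2
  constructor <;> linarith

lemma midFloor_apply (x y : Fin n → ℤ) (i : Fin n) : midFloor x y i = (x i + y i) / 2 := by
  rw [midFloor, Int.floor_eq_iff]
  have a1 : 2 * ((x i + y i) / 2) ≤ x i + y i := by omega
  have a2 : x i + y i < 2 * ((x i + y i) / 2) + 2 := by omega
  generalize (x i + y i) / 2 = c at *
  have a1' : (2 * c : ℚ) ≤ x i + y i := by exact_mod_cast a1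
  have a2' : (x i + y i : ℚ) < 2 * c + 2 := by exact_mod_cast a2
  constructor <;> linarith

lemma midCeil_add_midFloor (x y : Fin n → ℤ) : midCeil x y + midFloor x y = x + y := by
  ext i
  simp only [Pi.add_apply, midCeil_apply, midFloor_apply]
  omega

lemma near_midCeil_midFloor (x y : Fin n → ℤ) : Near (midCeil x y) (midFloor x y) := by
  intro i
  rw [midCeil_apply, midFloor_apply, abs_le]
  omega

lemma two_le_norm_of_not_near {x y : Fin n → ℤ} (h : ¬ Near x y) : 2 ≤ ‖x - y‖ := by
  simp only [Near, not_forall, not_le] at h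
  obtain ⟨i, hi⟩ := h
  refine le_trans ?_ (norm_le_pi_norm (x - y) i)
  rw [Pi.sub_apply, Int.norm_eq_abs, ← Int.cast_abs]
  exact_mod_cast hi

lemma IsLocallyDMC.isRoundedMidpointConvex {f : (Fin n → ℤ) → WithTop ℝ}
    (hf : IsLocallyDMC f) : IsRoundedMidpointConvex f := by
  obtain ⟨⟨-, hS⟩, hmid⟩ := hf
  constructor
  · intro x hx y hy
    by_cases hn : Near x y
    · exact ⟨x, hx, y, hy, rfl, hn⟩
    · obtain ⟨h1, h2⟩ := hS x hx y hy (two_le_norm_of_not_near hn)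
      exact ⟨_, h1, _, h2, midCeil_add_midFloor x y, near_midCeil_midFloor x y⟩
  · intro x y hxy
    by_cases hn : Near x y
    · exact ⟨x, y, rfl, hn, le_rfl⟩
    · refine ⟨_, _, midCeil_add_midFloor x y, near_midCeil_midFloor x y, hmid x y ?_⟩
      refine le_antisymm ((pi_norm_le_iff_of_nonneg zero_le_two).2 fun i => ?_)
        (two_le_norm_of_not_near hn)
      rw [Pi.sub_apply, Int.norm_eq_abs, ← Int.cast_abs]
      exact_mod_cast hxy i

lemma IsGloballyDMC.isLocallyDMC {f : (Fin n → ℤ) → WithTop ℝ}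
    (hf : IsGloballyDMC f) : IsLocallyDMC f :=
  ⟨⟨hf.1, fun x hx y hy hxy => mem_effDom_of_add_le hx hy (hf.2 x y hxy)⟩,
    fun x y hxy => hf.2 x y hxy.ge⟩

/-- The `ℤ`-linear map `y ↦ (0, y₁, y₁ + y₂, …, y₁ + ⋯ + yₙ)`. -/
def partialSums (n : ℕ) : (Fin n → ℤ) →ₗ[ℤ] (Fin (n + 1) → ℤ) where
  toFun y k := ∑ j with j.castSucc < k, y j
  map_add' y z := by ext k; simp [Finset.sum_add_distrib]
  map_smul' a y := by ext k; simp [Finset.mul_sum]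

lemma partialSums_succ_sub_castSucc (y : Fin n → ℤ) (i : Fin n) :
    partialSums n y i.succ - partialSums n y i.castSucc = y i := by
  have : (Finset.univ.filter fun j : Fin n => j.castSucc < i.succ)
      = insert i (Finset.univ.filter fun j : Fin n => j.castSucc < i.castSucc) := by
    ext j
    simp only [Finset.mem_filter, Finset.mem_univ, true_and, Finset.mem_insert, Fin.lt_def,
      Fin.val_castSucc, Fin.val_succ, Fin.ext_iff]
    omega
  simp only [partialSums, LinearMap.coe_mk, AddHom.coe_mk]
  rw [this, Finset.sum_insert (by simp)]
  ring

/-- A multimodular function is the pullback, along `partialSums`, of the L-convex function of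
consecutive differences. -/
lemma IsMultimodular.hasIntegralMinorants {f : (Fin n → ℤ) → WithTop ℝ}
    (hint : IsIntegerValued f) (hf : IsMultimodular f) : HasIntegralMinorants f := by
  set g : (Fin (n + 1) → ℤ) → WithTop ℝ := fun x => f (fun i => x i.succ - x i.castSucc) with hg
  have hfg : ∀ y, g (partialSums n y) = f y := fun y => by
    simp only [hg, partialSums_succ_sub_castSucc]
  have hdom : (effDom g).Nonempty := by
    obtain ⟨y, hy⟩ := hf.1
    exact ⟨partialSums n y, (hfg y).trans_lt hy⟩
  have hL : IsLConvex g := ⟨hdom, hf.2, 0, fun x => by simp [hg]⟩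
  have := (hL.isRoundedMidpointConvex.hasIntegralMinorants hdom
    fun x => hint _).comp_linearMap (partialSums n)
  simpa only [hfg] using this

end DiscreteConvex

theorem mainTheorem1 {n : ℕ} (f : (Fin n → ℤ) → WithTop ℝ)
    (hdom : (effDom f).Nonempty) (hint : IsIntegerValued f) :
    (IsSeparableConvex f → EqIntegralBiconjugate f) ∧
    (IsLNaturalConvex f → EqIntegralBiconjugate f) ∧
    (IsLConvex f → EqIntegralBiconjugate f) ∧
    (IsMNaturalConvex f → EqIntegralBiconjugate f) ∧
    (IsMConvex f → EqIntegralBiconjugate f) ∧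
    (IsMultimodular f → EqIntegralBiconjugate f) ∧
    (IsGloballyDMC f → EqIntegralBiconjugate f) ∧
    (IsLocallyDMC f → EqIntegralBiconjugate f) := by
  have key : IsRoundedMidpointConvex f → EqIntegralBiconjugate f := fun h =>
    (h.hasIntegralMinorants hdom hint).eqIntegralBiconjugate hint
  refine ⟨fun h => key h.isRoundedMidpointConvex, fun h => key ?_,
    fun h => key h.isRoundedMidpointConvex, fun h => key h.isRoundedMidpointConvex,
    fun h => key h.1.isRoundedMidpointConvex,
    fun h => (h.hasIntegralMinorants hint).eqIntegralBiconjugate hint,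
    fun h => key h.isLocallyDMC.isRoundedMidpointConvex,
    fun h => key h.isRoundedMidpointConvex⟩
  have hglobal : IsGloballyDMC f := ⟨h.1, fun x y _ => h.2 x y⟩
  exact hglobal.isLocallyDMC.isRoundedMidpointConvex
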